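/- Let $\mathbb F$ be $\mathbb R$ or $\mathbb C$ and let $\mathcal A$ be a unital $C^*$-algebra over $\mathbb F$. (For $\mathbb F=\mathbb R$ this means a real unital Banach $*$-algebra with $\|x^*x\|=\|x\|^2$ and $1+x^*x$ invertible for every $x\in\mathcal A$.) A cyclic representation $(\mathcal H,\pi,\xi)$ of $\mathcal A$ consists of a Hilbert space $\mathcal H$ over $\mathbb F$, a unital $*$-homomorphism $\pi$ from $\mathcal A$ to the bounded operators on $\mathcal H$, and a unit vector $\xi\in\mathcal H$ such that $\{\pi(c)\xi : c\in\mathcal A\}$ is dense in $\mathcal H$. The inner product $\langle\cdot\,|\,\cdot\rangle$ is linear in the first variable. Let $a\in\mathcal A$ and let $\mathcal B$ be an $\mathbb F$-linear subspace of $\mathcal A$ that is not dense in $\mathcal A$. Suppose that there is a best approximation to $a$ in $\mathcal B$, that is, some $b_0\in\mathcal B$ with $\|a-b_0\|\le\|a-b\|$ for all $b\in\mathcal B$. Then $$\operatorname{dist}(a,\mathcal B)=\max\bigl\{\,|\langle\pi(a)\xi\,|\,\eta\rangle| \;:\; (\mathcal H,\pi,\xi)\text{ is a cyclic representation of }\mathcal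 A,\ \eta\in\mathcal H,\ \|\eta\|=1,\ \langle\pi(b)\xi\,|\,\eta\rangle=0\text{ for all }b\in\mathcal B\bigr\},$$ where $\operatorname{dist}(a,\mathcal B)=\inf\{\|a-b\| : b\in\mathcal B\}$; in particular the set on the right is non-empty and the maximum is attained. -/

import Mathlib

universe u v

/-- Positivity axiom for a unital Banach `*`-algebra satisfying the C*-identity: every
`1 + x⋆ x` is invertible. A *real* C*-algebra is a real Banach `*`-algebra with the C*-identity and
this property (the C*-identity alone is too weak over `ℝ`: it holds for `ℂ` with the trivial
involution). Over `ℂ` the property is automatic, see the instance below. -/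
class PositiveStarSquares (A : Type u) [Ring A] [StarRing A] : Prop where
  isUnit_one_add_star_mul_self : ∀ x : A, IsUnit (1 + star x * x)

/-- Every complex unital C*-algebra has the property, so in the complex case it adds nothing. -/
instance CStarAlgebra.positiveStarSquares (A : Type u) [CStarAlgebra A] :
    PositiveStarSquares A where
  isUnit_one_add_star_mul_self x := by
    let _ := CStarAlgebra.spectralOrder A
    have := CStarAlgebra.spectralOrderedRing A
    by_contra h
    have h1 : (-1 : ℝ) ∈ spectrum ℝ (star x * x) := by
      rw [spectrum.mem_iff]
      intro h2
      apply h
      have h3 : (1 + star x * x) = -(algebraMap ℝ A (-1) - star x * x) := by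
        simp [add_comm]
      rw [h3]
      exact h2.neg
    have h4 := spectrum_nonneg_of_nonneg (star_mul_self_nonneg x) h1
    norm_num at h4

/-- `b₀` is a best approximation to `a` in the subspace `B`. -/
def IsBestApproximation {𝕜 : Type v} {A : Type u} [RCLike 𝕜] [NormedRing A] [NormedAlgebra 𝕜 A]
    (a : A) (B : Submodule 𝕜 A) (b₀ : A) : Prop :=
  b₀ ∈ B ∧ ∀ b ∈ B, ‖a - b₀‖ ≤ ‖a - b‖

/-- A cyclic representation `(H, π, ξ)` of a unital C*-algebra `A` over `𝕜`: a Hilbert space `H`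
over `𝕜`, a unital `*`-homomorphism `π` into the bounded operators on `H`, and a unit vector `ξ`
whose orbit `{π c ξ : c ∈ A}` is dense in `H`. Such an `H` has at most the size of a completion of
a quotient of `A`, so up to unitary equivalence all of them live in the universe of `A`. -/
structure CyclicRepresentation (𝕜 : Type v) (A : Type u) [RCLike 𝕜] [NormedRing A] [StarRing A]
    [NormedAlgebra 𝕜 A] where
  H : Type u
  [normedAddCommGroup : NormedAddCommGroup H]
  [innerProductSpace : InnerProductSpace 𝕜 H]
  [completeSpace : CompleteSpace H]
  π : A →⋆ₐ[𝕜] (H →L[𝕜] H)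
  ξ : H
  norm_ξ : ‖ξ‖ = 1
  cyclic : DenseRange fun c : A => π c ξ

attribute [instance] CyclicRepresentation.normedAddCommGroup
  CyclicRepresentation.innerProductSpace CyclicRepresentation.completeSpace

/-! Upper bound: `η` annihilates `π(B)ξ`, so `a` may be replaced by `a - b`; since `π` is
contractive, Cauchy-Schwarz gives at most `‖a - b‖`.

Attainment: Hahn-Banach in the quotient by the closure of `B` gives a norm-one `f` that vanishes on
`B` and takes the distance as its value at `a`. It remains to write `f` as a vector functional of a
cyclic representation (`exists_cyclicRepresentation`). The key is a positive functional `φ`, bounded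
by the norm, with `‖f c‖ ^ 2 ≤ φ (star c * c)` (`exists_dominating_functional`). Then `f` descends
to the GNS space of `φ`, and Riesz representation supplies `η`.

Such a `φ` exists because `∑ ‖f cᵢ‖ ^ 2 ≤ ‖∑ star cᵢ * cᵢ‖` (`Majorizes.le_norm`). This rests on
order properties of the norm, drawn for both scalar fields from one fact: a selfadjoint element
attains its norm on its real spectrum. -/

/-! ### Norm and real spectrum of selfadjoint elements -/

section SpectralRadius

variable {A : Type*} [NormedRing A] [NormedAlgebra ℝ A]

/-- A real normed algebra acts on the complex normed space of its bounded real-linear maps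
into `ℂ`, by `(a • φ) b = φ (b * a)`. -/
noncomputable def complexDualAction (A : Type*) [NormedRing A] [NormedAlgebra ℝ A] :
    A →+* ((A →L[ℝ] ℂ) →L[ℂ] (A →L[ℝ] ℂ)) where
  toFun a := LinearMap.mkContinuous
    { toFun := fun φ => φ.comp ((ContinuousLinearMap.mul ℝ A).flip a)
      map_add' := fun _ _ => rfl
      map_smul' := fun _ _ => rfl } ‖(ContinuousLinearMap.mul ℝ A).flip a‖
    (fun φ => (ContinuousLinearMap.opNorm_comp_le _ _).trans_eq (mul_comm _ _))
  map_one' := by ext φ b; change φ (b * 1) = φ b; rw [mul_one]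
  map_mul' a b := by
    ext φ c; change φ (c * (a * b)) = φ (c * a * b); rw [mul_assoc]
  map_zero' := by ext φ b; change φ (b * 0) = 0; rw [mul_zero, map_zero]
  map_add' a b := by
    ext φ c; change φ (c * (a + b)) = φ (c * a) + φ (c * b); rw [mul_add, map_add]

theorem complexDualAction_apply (a b : A) (φ : A →L[ℝ] ℂ) :
    complexDualAction A a φ b = φ (b * a) := rfl

/-- A real functional norming `a`, viewed as complex-valued, is a test vector for the action;
evaluating its image at `1` recovers `‖a‖`. -/
theorem norm_le_norm_complexDualAction [NormOneClass A] (a : A) :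
    ‖a‖ ≤ ‖complexDualAction A a‖ := by
  obtain ⟨g, hg, hga⟩ := exists_dual_vector'' ℝ a
  set φ : A →L[ℝ] ℂ := Complex.ofRealCLM.comp g with hφ
  have h1 : ‖φ‖ ≤ 1 := by
    refine φ.opNorm_le_bound zero_le_one fun x => ?_
    simpa [hφ] using g.le_of_opNorm_le hg x
  have h2 : complexDualAction A a φ 1 = (‖a‖ : ℂ) := by
    simp [complexDualAction_apply, hφ, hga]
  calc ‖a‖ = ‖complexDualAction A a φ 1‖ := by rw [h2]; simp
    _ ≤ ‖complexDualAction A a φ‖ * ‖(1 : A)‖ := ContinuousLinearMap.le_opNorm _ _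
    _ ≤ ‖complexDualAction A a‖ * ‖φ‖ := by
        rw [norm_one, mul_one]; exact ContinuousLinearMap.le_opNorm _ _
    _ ≤ ‖complexDualAction A a‖ := mul_le_of_le_one_right (norm_nonneg (complexDualAction A a)) h1

omit [NormedAlgebra ℝ A] in
theorem norm_pow_two_pow_of_star_eq [StarRing A] [CStarRing A] {x : A} (hx : star x = x) (n : ℕ) :
    ‖x ^ 2 ^ n‖ = ‖x‖ ^ 2 ^ n := by
  induction n with
  | zero => simp
  | succ k ih =>
    have h : star (x ^ 2 ^ k) = x ^ 2 ^ k := by rw [star_pow, hx]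
    rw [pow_succ 2 k, pow_mul, pow_mul, sq, ← ih, sq]
    nth_rewrite 1 [← h]
    exact CStarRing.norm_star_mul_self

/-- The norm of a selfadjoint element is attained on its real spectrum, as soon as non-real
spectral values are excluded. The spectral radius is computed in a complex Banach algebra `C`
into which `A` maps by a norm-nondecreasing homomorphism. -/
theorem exists_spectrum_abs_eq_norm_of_complex [NormOneClass A] [CompleteSpace A] [StarRing A]
    [CStarRing A] {C : Type*} [NormedRing C] [NormedAlgebra ℂ C] [CompleteSpace C]
    (j : A →+* C) (hj : ∀ a, ‖a‖ ≤ ‖j a‖)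
    (hjr : ∀ r : ℝ, j (algebraMap ℝ A r) = algebraMap ℂ C (r : ℂ))
    {x : A} (hx : star x = x)
    (hu : ∀ α β : ℝ, β ≠ 0 →
      IsUnit ((x - algebraMap ℝ A α) * (x - algebraMap ℝ A α) + algebraMap ℝ A (β * β))) :
    ∃ r ∈ spectrum ℝ x, |r| = ‖x‖ := by
  have : Nontrivial A := NormOneClass.nontrivial (G := A)
  have : Nontrivial C := by
    refine ⟨j 1, 0, fun h => ?_⟩
    have := hj (1 : A)
    rw [h, norm_one, norm_zero] at this
    linarith
  obtain ⟨z, hz, hzr⟩ := spectrum.exists_nnnorm_eq_spectralRadius (j x)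
  -- Gelfand's formula is used along the exponents `2 ^ n`, where the C*-identity computes the norms
  -- of the powers of `x` exactly.
  have hlim := (spectrum.pow_nnnorm_pow_one_div_tendsto_nhds_spectralRadius (j x)).comp
    (tendsto_pow_atTop_atTop_of_one_lt (one_lt_two : 1 < 2))
  have hle : (‖x‖₊ : ENNReal) ≤ ‖z‖₊ := by
    rw [hzr]
    refine ge_of_tendsto' hlim fun n => ?_
    have h1 : ‖x‖₊ ^ 2 ^ n ≤ ‖j x ^ 2 ^ n‖₊ := by
      rw [← NNReal.coe_le_coe]
      push_cast
      rw [← norm_pow_two_pow_of_star_eq hx, ← map_pow]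
      exact hj _
    have h2 : (‖x‖₊ : ENNReal) ^ 2 ^ n ≤ (‖j x ^ 2 ^ n‖₊ : ENNReal) := by exact_mod_cast h1
    have h3 := ENNReal.rpow_le_rpow h2 (z := 1 / ((2 ^ n : ℕ) : ℝ)) (by positivity)
    rw [← ENNReal.rpow_natCast, ← ENNReal.rpow_mul, mul_one_div_cancel (by positivity),
      ENNReal.rpow_one] at h3
    exact h3
  have hle' : ‖x‖ ≤ ‖z‖ := by exact_mod_cast hle
  have him : z.im = 0 := by
    by_contra hne
    -- The invertible element `(x - Re z)² + (Im z)²` maps to `(z - j x)(z̄ - j x)`. The factors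
    -- commute, so `z - j x` would be invertible.
    have h1 := (hu z.re z.im hne).map j
    have h2 : j ((x - algebraMap ℝ A z.re) * (x - algebraMap ℝ A z.re)
        + algebraMap ℝ A (z.im * z.im)) =
        (algebraMap ℂ C z - j x) * (algebraMap ℂ C (star z) - j x) := by
      rw [map_add, map_mul, map_sub, hjr, hjr]
      have e1 : (algebraMap ℂ C ((z.im * z.im : ℝ) : ℂ)) =
          algebraMap ℂ C z * algebraMap ℂ C (star z) -
            algebraMap ℂ C (z.re : ℂ) * algebraMap ℂ C (z.re : ℂ) := by
        rw [← map_mul, ← map_mul, ← map_sub]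
        congr 1
        apply Complex.ext <;> simp <;> ring
      have e2 : (algebraMap ℂ C (z.re : ℂ)) +
          algebraMap ℂ C (z.re : ℂ) = algebraMap ℂ C z + algebraMap ℂ C (star z) := by
        rw [← map_add, ← map_add]
        congr 1
        apply Complex.ext <;> simp
      have e3 := Algebra.commutes (z.re : ℂ) (j x)
      rw [e1, sub_mul, mul_sub, mul_sub, sub_mul, mul_sub, mul_sub, e3]
      have e5 := congrArg (fun T => j x * T) e2
      simp only [mul_add] at e5
      rw [← Algebra.commutes z (j x)] at e5
      rw [← sub_eq_zero] at e5 ⊢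
      rw [← neg_eq_zero, ← e5]
      abel
    rw [h2] at h1
    have hc : Commute (algebraMap ℂ C z - j x) (algebraMap ℂ C (star z) - j x) := by
      apply Commute.sub_left
      · exact Algebra.commutes _ _
      · exact Commute.sub_right (Algebra.commutes _ _).symm rfl
    exact hz (hc.isUnit_mul_iff.1 h1).1
  have hzre : z = (z.re : ℂ) := by apply Complex.ext <;> simp [him]
  have hmem : z.re ∈ spectrum ℝ x := by
    intro h
    apply hz
    have := h.map j
    rw [map_sub, hjr, ← hzre] at this
    exact this
  refine ⟨z.re, hmem, le_antisymm ?_ ?_⟩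
  · simpa using spectrum.norm_le_norm_of_mem hmem
  · rw [hzre] at hle'
    simpa using hle'

theorem exists_spectrum_abs_eq_norm [NormOneClass A] [CompleteSpace A] [StarRing A] [CStarRing A]
    {x : A} (hx : star x = x)
    (hu : ∀ α β : ℝ, β ≠ 0 →
      IsUnit ((x - algebraMap ℝ A α) * (x - algebraMap ℝ A α) + algebraMap ℝ A (β * β))) :
    ∃ r ∈ spectrum ℝ x, |r| = ‖x‖ := by
  refine exists_spectrum_abs_eq_norm_of_complex (C := (A →L[ℝ] ℂ) →L[ℂ] (A →L[ℝ] ℂ))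
    (complexDualAction A) (fun a => norm_le_norm_complexDualAction a) (fun r => ?_) hx hu
  rw [Algebra.algebraMap_eq_smul_one, Algebra.algebraMap_eq_smul_one]
  ext φ b
  change φ (b * (r • 1)) = (r : ℂ) • φ b
  rw [mul_smul_comm, mul_one, map_smul, Complex.coe_smul]

end SpectralRadius

/-! ### Positivity expressed through the norm -/

section NormPositive

variable {A : Type*} [NormedRing A] [StarRing A] [NormedAlgebra ℝ A]

/-- Selfadjoint elements lying in a ball centred at a positive scalar and with `0` on its
boundary. In a real C*-algebra these are the positive elements. -/
def NormPositive (h : A) : Prop :=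
  star h = h ∧ ∃ t : ℝ, ‖algebraMap ℝ A t - h‖ ≤ t

theorem NormPositive.zero : NormPositive (0 : A) := ⟨star_zero _, 0, by simp⟩

theorem NormPositive.add {h k : A} (hh : NormPositive h) (hk : NormPositive k) :
    NormPositive (h + k) := by
  obtain ⟨h1, s, hs⟩ := hh
  obtain ⟨k1, t, ht⟩ := hk
  refine ⟨by rw [star_add, h1, k1], s + t, ?_⟩
  rw [map_add, add_sub_add_comm]
  exact (norm_add_le _ _).trans (add_le_add hs ht)

theorem NormPositive.smul {h : A} [StarModule ℝ A] (hh : NormPositive h) {c : ℝ} (hc : 0 ≤ c) :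
    NormPositive (c • h) := by
  obtain ⟨h1, s, hs⟩ := hh
  refine ⟨by rw [star_smul, h1, star_trivial], c * s, ?_⟩
  rw [map_mul, ← Algebra.smul_def, ← smul_sub, norm_smul, Real.norm_of_nonneg hc]
  gcongr

theorem star_algebraMap_real {A : Type*} [NormedRing A] [StarRing A] [NormedAlgebra ℝ A]
    [StarModule ℝ A] (r : ℝ) : star (algebraMap ℝ A r) = algebraMap ℝ A r := by
  rw [← algebraMap_star_comm, star_trivial]

theorem isUnit_star_mul_self_add_algebraMap [StarModule ℝ A] [PositiveStarSquares A] (c : A)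
    {r : ℝ} (hr : 0 < r) :
    IsUnit (star c * c + algebraMap ℝ A r) := by
  have h := PositiveStarSquares.isUnit_one_add_star_mul_self ((√r)⁻¹ • c)
  have h2 : star c * c + algebraMap ℝ A r =
      algebraMap ℝ A r * (1 + star ((√r)⁻¹ • c) * ((√r)⁻¹ • c)) := by
    rw [star_smul, star_trivial (√r)⁻¹, smul_mul_smul_comm, ← mul_inv, Real.mul_self_sqrt hr.le,
      mul_add, mul_one, ← Algebra.smul_def, smul_smul, mul_inv_cancel₀ hr.ne', one_smul, add_comm]
  rw [h2]
  exact ((isUnit_iff_ne_zero.2 hr.ne').map (algebraMap ℝ A)).mul h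

theorem abs_sub_le_of_mem_spectrum {A : Type*} [NormedRing A] [NormedAlgebra ℝ A]
    [CompleteSpace A] [NormOneClass A] {x : A} {r t s : ℝ} (hr : r ∈ spectrum ℝ x)
    (h : ‖algebraMap ℝ A t - x‖ ≤ s) : |t - r| ≤ s := by
  have h1 : t - r ∈ spectrum ℝ (algebraMap ℝ A t - x) := by
    rw [← spectrum.singleton_sub_eq]
    exact Set.sub_mem_sub rfl hr
  exact (spectrum.norm_le_norm_of_mem h1).trans h

variable [CompleteSpace A] [CStarRing A] [StarModule ℝ A] [PositiveStarSquares A] [NormOneClass A]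

theorem exists_spectrum_abs_eq_norm_of_star_eq {x : A} (hx : star x = x) :
    ∃ r ∈ spectrum ℝ x, |r| = ‖x‖ := by
  refine exists_spectrum_abs_eq_norm hx fun α β hβ => ?_
  have h := isUnit_star_mul_self_add_algebraMap (x - algebraMap ℝ A α)
    (mul_self_pos.2 hβ)
  rwa [star_sub, hx, star_algebraMap_real] at h

/-- The invertibility axiom, rescaled, excludes negative spectrum. With `t = ‖star c * c‖`, the
spectrum of `t - star c * c` thus lies in `[0, t]`, and it carries the norm. -/
theorem NormPositive.star_mul_self (c : A) : NormPositive (star c * c) := by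
  have hs : star (star c * c) = star c * c := by rw [star_mul, star_star]
  refine ⟨hs, ‖star c * c‖, ?_⟩
  set t := ‖star c * c‖ with ht
  obtain ⟨r, hr, hrn⟩ := exists_spectrum_abs_eq_norm_of_star_eq
    (x := algebraMap ℝ A t - star c * c) (by rw [star_sub, star_algebraMap_real, hs])
  rw [← hrn]
  rw [← spectrum.singleton_sub_eq, Set.singleton_sub] at hr
  obtain ⟨l, hl, rfl⟩ := hr
  have h1 : |l| ≤ t := spectrum.norm_le_norm_of_mem hl
  have h2 : 0 ≤ l := by
    by_contra! hneg
    apply hl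
    have := (isUnit_star_mul_self_add_algebraMap c (neg_pos.2 hneg)).neg
    rwa [map_neg, neg_add_rev, neg_neg, ← sub_eq_add_neg] at this
  rw [abs_le] at h1 ⊢
  constructor <;> simp only <;> linarith

/-- Let `r` be a spectral value of `x` with `|r| = ‖x‖`. The ball for `x` forces `r ≥ 0`; the ball
for `y`, through `t + x = (t - y) + (x + y)`, forces `r ≤ ‖x + y‖`. -/
theorem NormPositive.norm_le_norm_add {x y : A} (hx : NormPositive x) (hy : NormPositive y) :
    ‖x‖ ≤ ‖x + y‖ := by
  obtain ⟨r, hr, hrn⟩ := exists_spectrum_abs_eq_norm_of_star_eq hx.1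
  obtain ⟨s, hs⟩ := hx.2
  obtain ⟨t, ht⟩ := hy.2
  have h1 := abs_le.1 (abs_sub_le_of_mem_spectrum hr hs)
  have h2 : ‖algebraMap ℝ A (-t) - x‖ ≤ t + ‖x + y‖ := by
    have : algebraMap ℝ A (-t) - x = -((algebraMap ℝ A t - y) + (x + y)) := by
      rw [map_neg]; abel
    rw [this, norm_neg]
    exact (norm_add_le _ _).trans (by gcongr)
  have h3 := abs_le.1 (abs_sub_le_of_mem_spectrum hr h2)
  rw [← hrn, abs_le]
  constructor <;> linarith

end NormPositive

/-! ### A positive functional dominating `‖f c‖ ^ 2` -/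

section DominatingFunctional

variable {𝕜 : Type*} {A : Type*} [RCLike 𝕜] [NormedRing A] [StarRing A] [NormedAlgebra 𝕜 A]
  [StarModule 𝕜 A] [NormedAlgebra ℝ A] [IsScalarTower ℝ 𝕜 A] [StarModule ℝ A]

/-- A property of pairs `(k, r)` that is stable under addition, and holds for
`(star c * c, ‖f c‖ ^ 2)`. -/
def Majorizes (f : StrongDual 𝕜 A) (k : A) (r : ℝ) : Prop :=
  0 ≤ r ∧ ∃ v : A, f v = (r : 𝕜) ∧
    ∀ w : A, NormPositive (k - star v * w - star w * v + r • (star w * w))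

omit [StarModule 𝕜 A] [IsScalarTower ℝ 𝕜 A] [StarModule ℝ A] in
theorem Majorizes.zero (f : StrongDual 𝕜 A) : Majorizes f 0 0 :=
  ⟨le_rfl, 0, by simp, fun w => by simpa using NormPositive.zero⟩

omit [StarModule 𝕜 A] [IsScalarTower ℝ 𝕜 A] [StarModule ℝ A] in
theorem Majorizes.add {f : StrongDual 𝕜 A} {k l : A} {r s : ℝ} (h : Majorizes f k r)
    (h' : Majorizes f l s) : Majorizes f (k + l) (r + s) := by
  obtain ⟨hr, v, hv, hw⟩ := h
  obtain ⟨hs, v', hv', hw'⟩ := h'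
  refine ⟨add_nonneg hr hs, v + v', by rw [map_add, hv, hv']; simp, fun w => ?_⟩
  convert (hw w).add (hw' w) using 1
  rw [star_add, add_mul, mul_add, add_smul]
  abel

omit [StarModule 𝕜 A] in
theorem Majorizes.smul {f : StrongDual 𝕜 A} {k : A} {r c : ℝ} (h : Majorizes f k r)
    (hc : 0 ≤ c) : Majorizes f (c • k) (c * r) := by
  obtain ⟨hr, v, hv, hw⟩ := h
  refine ⟨mul_nonneg hc hr, c • v, ?_, fun w => ?_⟩
  · rw [← algebraMap_smul 𝕜 c v, map_smul, hv]
    simp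
  · convert (hw w).smul hc using 1
    rw [star_smul, star_trivial c, smul_add, smul_sub, smul_sub, smul_mul_assoc, mul_smul_comm,
      mul_smul]

variable [CompleteSpace A] [CStarRing A] [PositiveStarSquares A] [NormOneClass A]

omit [CompleteSpace A] [CStarRing A] [PositiveStarSquares A] [NormOneClass A]
  [NormedAlgebra ℝ A] [IsScalarTower ℝ 𝕜 A] [StarModule ℝ A] in
theorem star_sub_smul_mul_self (c w : A) (z : 𝕜) :
    star (c - z • w) * (c - z • w) = star c * c - z • (star c * w) - star z • (star w * c)
      + (star z * z) • (star w * w) := by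
  rw [star_sub, star_smul, sub_mul, mul_sub, mul_sub, mul_smul_comm, smul_mul_assoc,
    smul_mul_smul_comm]
  abel

/-- With `v = star (f c) • c`, the required expression is the square `star (c - f c • w) * (c - f c
• w)`. -/
theorem Majorizes.star_mul_self (f : StrongDual 𝕜 A) (c : A) :
    Majorizes f (star c * c) (‖f c‖ ^ 2) := by
  refine ⟨by positivity, star (f c) • c, ?_, fun w => ?_⟩
  · rw [map_smul, smul_eq_mul, ← starRingEnd_apply, RCLike.conj_mul]
    simp
  · convert NormPositive.star_mul_self (c - f c • w) using 1
    rw [star_sub_smul_mul_self, star_smul, star_star, smul_mul_assoc, mul_smul_comm,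
      ← starRingEnd_apply, RCLike.conj_mul, ← algebraMap_smul 𝕜 (‖f c‖ ^ 2)]
    simp

omit [StarModule 𝕜 A] [IsScalarTower ℝ 𝕜 A] in
theorem Majorizes.le_norm {f : StrongDual 𝕜 A} (hf : ‖f‖ ≤ 1) {k : A} {r : ℝ}
    (h : Majorizes f k r) : r ≤ ‖k‖ := by
  obtain ⟨hr, v, hv, hw⟩ := h
  rcases hr.eq_or_lt with rfl | hr
  · exact norm_nonneg _
  -- This `w` completes the square: `k - r⁻¹ • (star v * v)` is positive, so `‖v‖ ^ 2 ≤ r * ‖k‖`,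
  -- while `r = f v` gives `r ≤ ‖v‖`.
  have h1 := hw (r⁻¹ • v)
  have h2 : NormPositive (r⁻¹ • (star v * v)) :=
    (NormPositive.star_mul_self v).smul (inv_nonneg.2 hr.le)
  have h3 : r⁻¹ • (star v * v) + (k - star v * (r⁻¹ • v) - star (r⁻¹ • v) * v +
      r • (star (r⁻¹ • v) * (r⁻¹ • v))) = k := by
    rw [star_smul, star_trivial r⁻¹, mul_smul_comm, smul_mul_smul_comm, smul_mul_assoc, smul_smul,
      mul_inv_cancel_left₀ hr.ne']
    abel
  have h4 := h2.norm_le_norm_add h1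
  rw [h3, norm_smul, CStarRing.norm_star_mul_self, norm_inv, Real.norm_of_nonneg hr.le] at h4
  have h5 : r ≤ ‖v‖ := by
    have := f.le_of_opNorm_le hf v
    rwa [hv, one_mul, RCLike.norm_ofReal, abs_of_pos hr] at this
  refine le_trans ?_ h4
  rw [le_inv_mul_iff₀ hr]
  exact mul_self_le_mul_self hr.le h5

/-- The cone of pairs `(h, t)` on which `t - φ h` is required to be nonnegative, for a functional
`φ` bounded by the norm and dominating `‖f c‖ ^ 2` at `star c * c`. -/
noncomputable def majorizationCone (f : StrongDual 𝕜 A) : PointedCone ℝ (A × ℝ) where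
  carrier := {p | ∃ k r, Majorizes f k r ∧ ‖p.1 + k‖ - r ≤ p.2}
  zero_mem' := ⟨0, 0, Majorizes.zero f, by simp⟩
  add_mem' := by
    rintro p q ⟨k, r, h, hp⟩ ⟨l, s, h', hq⟩
    refine ⟨k + l, r + s, h.add h', ?_⟩
    have := norm_add_le (p.1 + k) (q.1 + l)
    rw [add_add_add_comm] at this
    simp only [Prod.fst_add, Prod.snd_add]
    linarith
  smul_mem' := by
    rintro ⟨c, hc⟩ p ⟨k, r, h, hp⟩
    refine ⟨c • k, c * r, h.smul hc, ?_⟩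
    change ‖c • p.1 + c • k‖ - c * r ≤ c * p.2
    rw [← smul_add, norm_smul, Real.norm_of_nonneg hc, ← mul_sub]
    gcongr

/-- Hahn-Banach for the sublinear function `h ↦ inf (‖h + k‖ - r)` over majorizing pairs `(k, r)`,
phrased as extension of a functional nonnegative on a cone. The bound `r ≤ ‖k‖` is what makes `(0,
t) ↦ t` nonnegative there. -/
theorem exists_dominating_functional (f : StrongDual 𝕜 A) (hf : ‖f‖ ≤ 1) :
    ∃ φ : A →ₗ[ℝ] ℝ, (∀ h, φ h ≤ ‖h‖) ∧ (∀ h, φ (star h) = φ h) ∧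
      ∀ c, ‖f c‖ ^ 2 ≤ φ (star c * c) := by
  obtain ⟨g, hg, hgs⟩ := riesz_extension (majorizationCone f)
    ⟨LinearMap.range (LinearMap.inr ℝ A ℝ), (LinearMap.snd ℝ A ℝ).domRestrict _⟩
    (by
      rintro ⟨_, t, rfl⟩ ⟨k, r, h, hle⟩
      have := h.le_norm hf
      simp at hle ⊢
      linarith)
    (by
      rintro ⟨h, t⟩
      refine ⟨⟨(0, ‖h‖ - t), ‖h‖ - t, rfl⟩, 0, 0, Majorizes.zero f, ?_⟩
      simp)
  have hg1 : ∀ t, g (0, t) = t := fun t => hg ⟨(0, t), t, rfl⟩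
  have hgt : ∀ h t, g (h, t) = g (h, 0) + t := fun h t => by
    rw [← hg1 t, ← map_add]; simp [hg1]
  have key : ∀ h k r, Majorizes f k r → -g (h, 0) ≤ ‖h + k‖ - r := fun h k r hk => by
    have := hgs (h, ‖h + k‖ - r) ⟨k, r, hk, le_rfl⟩
    rw [hgt] at this
    linarith
  set φ : A →ₗ[ℝ] ℝ := -(g.comp (LinearMap.inl ℝ A ℝ)) with hφ
  have hφa : ∀ h, φ h = -g (h, 0) := fun h => rfl
  have h1 : ∀ h, φ h ≤ ‖h‖ := fun h => by
    have := key h 0 0 (Majorizes.zero f)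
    rwa [add_zero, sub_zero] at this
  have h2 : ∀ c, ‖f c‖ ^ 2 ≤ φ (star c * c) := fun c => by
    -- Choosing `h = -k` makes the norm term vanish.
    have := key (-(star c * c)) _ _ (Majorizes.star_mul_self f c)
    rw [← hφa, map_neg, neg_add_cancel, norm_zero] at this
    linarith
  let S : A →ₗ[ℝ] A :=
    { toFun := star
      map_add' := star_add
      map_smul' := fun r x => by simp }
  -- Averaging over the involution gives star-invariance; both bounds survive, as `star` is
  -- isometric and fixes `star c * c`.
  refine ⟨(1 / 2 : ℝ) • (φ + φ.comp S), fun h => ?_, fun h => ?_, fun c => ?_⟩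
  · change (1 / 2 : ℝ) * (φ h + φ (star h)) ≤ _
    have := h1 h
    have h3 := h1 (star h)
    rw [norm_star] at h3
    linarith
  · change (1 / 2 : ℝ) * (φ (star h) + φ (star (star h))) = (1 / 2 : ℝ) * (φ h + φ (star h))
    rw [star_star, add_comm]
  · change _ ≤ (1 / 2 : ℝ) * (φ (star c * c) + φ (star (star c * c)))
    rw [star_mul, star_star]
    have := h2 c
    linarith

end DominatingFunctional

/-! ### The GNS construction -/

theorem le_mul_of_sq_le_mul_succ {u : ℕ → ℝ} {q M C : ℝ} (hu : ∀ n, 0 ≤ u n) (hq : 0 ≤ q)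
    (hM : 0 ≤ M) (h : ∀ n, u n ^ 2 ≤ q * u (n + 1)) (hC : ∀ n, u n ≤ C * M ^ 2 ^ n) :
    u 0 ≤ q * M := by
  rcases hq.eq_or_lt with rfl | hq
  · have := h 0
    nlinarith [hu 0]
  -- The extra `q` on the left lets the induction close: squaring produces `q ^ 2`, and one factor
  -- cancels.
  have h1 : ∀ n, q * u 0 ^ 2 ^ n ≤ q ^ 2 ^ n * u n := by
    intro n
    induction n with
    | zero => simp
    | succ n ih =>
      have h2 := pow_le_pow_left₀ (by have := hu 0; positivity) ih 2
      rw [mul_pow, mul_pow, ← pow_mul, ← pow_mul, ← pow_succ] at h2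
      have h3 := mul_le_mul_of_nonneg_left (h n) (by positivity : 0 ≤ q ^ 2 ^ (n + 1))
      refine le_of_mul_le_mul_left ?_ hq
      linarith
  have h2 : ∀ n, q * u 0 ^ 2 ^ n ≤ C * (q * M) ^ 2 ^ n := fun n => by
    have := mul_le_mul_of_nonneg_left (hC n) (by positivity : 0 ≤ q ^ 2 ^ n)
    rw [mul_pow]
    linarith [h1 n]
  by_contra! hlt
  rcases (mul_nonneg hq.le hM).eq_or_lt with h0 | h0
  · have := h2 0
    rw [← h0] at this hlt
    simp at this
    nlinarith
  -- If `u 0 > q * M`, the powers of their ratio outgrow the constant `C / q`.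
  · obtain ⟨n, hn⟩ := pow_unbounded_of_one_lt (C / q) ((one_lt_div h0).2 hlt)
    have h3 : (u 0 / (q * M)) ^ n ≤ (u 0 / (q * M)) ^ 2 ^ n :=
      pow_le_pow_right₀ ((one_lt_div h0).2 hlt).le Nat.lt_two_pow_self.le
    have h4 := hn.trans_le h3
    rw [div_pow, div_lt_div_iff₀ hq (by positivity)] at h4
    linarith [h2 n]

/-- A positive functional on a normed `*`-algebra, hermitian and with real part bounded by the
norm. -/
structure BoundedPositiveFunctional (𝕜 : Type v) (A : Type u) [RCLike 𝕜] [NormedRing A]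
    [StarRing A] [NormedAlgebra 𝕜 A] where
  toLinear : A →ₗ[𝕜] 𝕜
  map_star : ∀ x, toLinear (star x) = starRingEnd 𝕜 (toLinear x)
  re_nonneg : ∀ x, 0 ≤ RCLike.re (toLinear (star x * x))
  re_le_norm : ∀ x, RCLike.re (toLinear x) ≤ ‖x‖

namespace BoundedPositiveFunctional

open UniformSpace Completion ContinuousLinearMap

variable {𝕜 : Type v} {A : Type u} [RCLike 𝕜] [NormedRing A] [StarRing A] [NormedAlgebra 𝕜 A]
  [StarModule 𝕜 A]

set_option linter.unusedVariables false in
/-- The type synonym of `A` carrying the semi-inner product `⟪a, b⟫ = σ (star a * b)`. -/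
@[nolint unusedArguments]
def PreGNS (σ : BoundedPositiveFunctional 𝕜 A) : Type u := A

variable (σ : BoundedPositiveFunctional 𝕜 A)

instance : AddCommGroup σ.PreGNS := inferInstanceAs (AddCommGroup A)
instance : Module 𝕜 σ.PreGNS := inferInstanceAs (Module 𝕜 A)

def toPreGNS : A ≃ₗ[𝕜] σ.PreGNS := LinearEquiv.refl 𝕜 _

def ofPreGNS : σ.PreGNS ≃ₗ[𝕜] A := σ.toPreGNS.symm

omit [StarModule 𝕜 A] in
@[simp]
theorem toPreGNS_ofPreGNS (a : σ.PreGNS) : σ.toPreGNS (σ.ofPreGNS a) = a := rfl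

omit [StarModule 𝕜 A] in
@[simp]
theorem ofPreGNS_toPreGNS (a : A) : σ.ofPreGNS (σ.toPreGNS a) = a := rfl

noncomputable abbrev preGNSCore : PreInnerProductSpace.Core 𝕜 σ.PreGNS where
  inner a b := σ.toLinear (star (σ.ofPreGNS a) * σ.ofPreGNS b)
  conj_inner_symm a b := by rw [← σ.map_star, star_mul, star_star]
  re_inner_nonneg _ := σ.re_nonneg _
  add_left _ _ _ := by rw [_root_.map_add, star_add, add_mul, _root_.map_add]
  smul_left := by simp

noncomputable instance : SeminormedAddCommGroup σ.PreGNS :=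
  InnerProductSpace.Core.toSeminormedAddCommGroup (c := σ.preGNSCore)
noncomputable instance : InnerProductSpace 𝕜 σ.PreGNS :=
  InnerProductSpace.ofCore σ.preGNSCore

theorem inner_def (a b : σ.PreGNS) :
    inner 𝕜 a b = σ.toLinear (star (σ.ofPreGNS a) * σ.ofPreGNS b) := rfl

theorem norm_sq_eq (a : σ.PreGNS) :
    ‖a‖ ^ 2 = RCLike.re (σ.toLinear (star (σ.ofPreGNS a) * σ.ofPreGNS a)) := by
  rw [norm_sq_eq_re_inner (𝕜 := 𝕜)]; rfl

theorem norm_toPreGNS_le [CStarRing A] (a : A) : ‖σ.toPreGNS a‖ ≤ ‖a‖ := by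
  refine le_of_sq_le_sq ?_ (norm_nonneg _)
  rw [norm_sq_eq, ofPreGNS_toPreGNS, sq, ← CStarRing.norm_star_mul_self]
  exact σ.re_le_norm _

theorem norm_toPreGNS_sq_le (a b : A) :
    ‖σ.toPreGNS (a * b)‖ ^ 2 ≤ ‖σ.toPreGNS b‖ * ‖σ.toPreGNS (star a * a * b)‖ := by
  have h : ‖σ.toPreGNS (a * b)‖ ^ 2 =
      RCLike.re (inner 𝕜 (σ.toPreGNS b) (σ.toPreGNS (star a * a * b))) := by
    rw [norm_sq_eq, inner_def]
    simp only [ofPreGNS_toPreGNS, star_mul, mul_assoc]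
  rw [h]
  exact re_inner_le_norm _ _

/-- Left multiplication is contractive for the GNS seminorm, by iterating the Cauchy-Schwarz
inequality. -/
theorem norm_toPreGNS_mul_le [CStarRing A] [NormOneClass A] (a b : A) :
    ‖σ.toPreGNS (a * b)‖ ≤ ‖a‖ * ‖σ.toPreGNS b‖ := by
  set h := star a * a with hh
  have hs : star h = h := by rw [hh, star_mul, star_star]
  have key := le_mul_of_sq_le_mul_succ (u := fun n => ‖σ.toPreGNS (h ^ 2 ^ n * b)‖)
    (q := ‖σ.toPreGNS b‖) (M := ‖h‖) (C := ‖b‖) (fun n => norm_nonneg _) (norm_nonneg _)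
    (norm_nonneg _) (fun n => by
      have := σ.norm_toPreGNS_sq_le (h ^ 2 ^ n) b
      rwa [star_pow, hs, ← sq, ← pow_mul, ← pow_succ] at this)
    (fun n => by
      refine (σ.norm_toPreGNS_le _).trans ((norm_mul_le _ _).trans ?_)
      rw [mul_comm]
      gcongr
      exact norm_pow_le _ _)
  simp only [pow_zero, pow_one] at key
  refine le_of_sq_le_sq ?_ (by positivity)
  refine (σ.norm_toPreGNS_sq_le a b).trans ?_
  rw [← hh, mul_pow, sq ‖a‖, ← CStarRing.norm_star_mul_self, ← hh]
  nlinarith [mul_le_mul_of_nonneg_left key (norm_nonneg (σ.toPreGNS b))]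

variable [CStarRing A] [NormOneClass A]

noncomputable def leftMul (a : A) : σ.PreGNS →L[𝕜] σ.PreGNS :=
  (σ.toPreGNS.toLinearMap ∘ₗ LinearMap.mulLeft 𝕜 a ∘ₗ σ.ofPreGNS.toLinearMap).mkContinuous ‖a‖
    fun x => σ.norm_toPreGNS_mul_le a (σ.ofPreGNS x)

@[simp]
theorem leftMul_apply (a : A) (x : σ.PreGNS) :
    σ.leftMul a x = σ.toPreGNS (a * σ.ofPreGNS x) := rfl

noncomputable def gnsHom : A →⋆ₐ[𝕜] (Completion σ.PreGNS →L[𝕜] Completion σ.PreGNS) where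
  toFun a := (σ.leftMul a).completion
  map_one' := by
    ext c
    induction c using induction_on with
      | hp => apply isClosed_eq <;> fun_prop
      | ih c => simp
  map_mul' _ _ := by
    ext c
    induction c using induction_on with
      | hp => apply isClosed_eq <;> fun_prop
      | ih c => simp [mul_assoc]
  map_zero' := by
    ext c
    induction c using induction_on with
      | hp => apply isClosed_eq <;> fun_prop
      | ih c => simpa using Completion.coe_zero
  map_add' _ _ := by
    ext c
    induction c using induction_on with
      | hp => apply isClosed_eq <;> fun_prop
      | ih c => simp [add_mul, Completion.coe_add]
  commutes' r := by
    ext c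
    induction c using induction_on with
      | hp => apply isClosed_eq <;> fun_prop
      | ih c => simp [Algebra.algebraMap_eq_smul_one]
  map_star' a := by
    refine (eq_adjoint_iff (σ.leftMul (star a)).completion (σ.leftMul a).completion).mpr ?_
    intro x y
    induction x, y using induction_on₂ with
    | hp => apply isClosed_eq <;> fun_prop
    | ih x y => simp [mul_assoc, inner_def]

theorem gnsHom_apply_coe (a b : A) :
    σ.gnsHom a (σ.toPreGNS b : Completion σ.PreGNS) =
      (σ.toPreGNS (a * b) : Completion σ.PreGNS) := by
  change (σ.leftMul a).completion _ = _
  simp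

omit [CStarRing A] [NormOneClass A] in
/-- A functional dominated by `σ` is a vector functional of the GNS representation. -/
theorem exists_inner_gnsHom_eq (f : StrongDual 𝕜 A)
    (hf : ∀ c, ‖f c‖ ^ 2 ≤ RCLike.re (σ.toLinear (star c * c))) :
    ∃ η : Completion σ.PreGNS, ‖η‖ ≤ 1 ∧
      ∀ c, inner 𝕜 η (σ.toPreGNS c : Completion σ.PreGNS) = f c := by
  let F : σ.PreGNS →L[𝕜] 𝕜 := (f.toLinearMap ∘ₗ σ.ofPreGNS.toLinearMap).mkContinuous 1
    fun x => by
      rw [one_mul]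
      refine le_of_sq_le_sq ?_ (norm_nonneg _)
      rw [norm_sq_eq]
      exact hf _
  let G : StrongDual 𝕜 (Completion σ.PreGNS) := F.extend (toComplL (𝕜 := 𝕜))
  have hG : ∀ x : σ.PreGNS, G x = F x := fun x =>
    ContinuousLinearMap.extend_eq F (e := toComplL (𝕜 := 𝕜)) (denseRange_coe)
      (isUniformInducing_coe _) x
  refine ⟨(InnerProductSpace.toDual 𝕜 _).symm G, ?_, fun c => ?_⟩
  · rw [LinearIsometryEquiv.norm_map]
    refine G.opNorm_le_bound zero_le_one fun x => ?_
    induction x using induction_on with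
    | hp => apply isClosed_le <;> fun_prop
    | ih x =>
      rw [hG, Completion.norm_coe]
      exact F.le_of_opNorm_le (LinearMap.mkContinuous_norm_le _ zero_le_one _) x
  · rw [InnerProductSpace.toDual_symm_apply, hG]
    rfl

end BoundedPositiveFunctional

/-! ### Representing functionals, and contractivity of representations -/

theorem starModule_real (𝕜 A : Type*) [RCLike 𝕜] [NormedRing A] [StarRing A] [NormedAlgebra 𝕜 A]
    [StarModule 𝕜 A] [NormedAlgebra ℝ A] [IsScalarTower ℝ 𝕜 A] : StarModule ℝ A :=
  ⟨fun r a => by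
    rw [← algebraMap_smul 𝕜 r a, ← algebraMap_smul 𝕜 (star r), star_smul]
    simp⟩

section Distance

variable {𝕜 : Type v} {A : Type u} [RCLike 𝕜] [NormedRing A] [StarRing A]
  [CStarRing A] [CompleteSpace A] [NormedAlgebra 𝕜 A] [StarModule 𝕜 A]

theorem exists_boundedPositiveFunctional [NormOneClass A] [PositiveStarSquares A]
    (f : StrongDual 𝕜 A) (hf : ‖f‖ ≤ 1) :
    ∃ σ : BoundedPositiveFunctional 𝕜 A,
      ∀ c, ‖f c‖ ^ 2 ≤ RCLike.re (σ.toLinear (star c * c)) := by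
  let _ : NormedAlgebra ℝ A := NormedAlgebra.restrictScalars ℝ 𝕜 A
  have : IsScalarTower ℝ 𝕜 A := RestrictScalars.isScalarTower ℝ 𝕜 A
  have : StarModule ℝ A := starModule_real 𝕜 A
  obtain ⟨φ, h1, h2, h3⟩ := exists_dominating_functional f hf
  refine ⟨⟨Module.Dual.extendRCLike φ, fun x => ?_, fun x => ?_, fun x => ?_⟩, fun c => ?_⟩
  · apply RCLike.ext
    · rw [RCLike.conj_re, Module.Dual.re_extendRCLike_apply, Module.Dual.re_extendRCLike_apply, h2]
    · rw [RCLike.conj_im, Module.Dual.im_extendRCLike_apply, Module.Dual.im_extendRCLike_apply,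
        ← h2 (_ • star x), star_smul, star_star, ← starRingEnd_apply, RCLike.conj_I, neg_smul,
        map_neg]
  · rw [Module.Dual.re_extendRCLike_apply]
    exact (sq_nonneg _).trans (h3 x)
  · rw [Module.Dual.re_extendRCLike_apply]
    exact h1 x
  · rw [Module.Dual.re_extendRCLike_apply]
    exact h3 c

theorem exists_cyclicRepresentation [NormOneClass A] [PositiveStarSquares A]
    (f : StrongDual 𝕜 A) (hf : ‖f‖ = 1) :
    ∃ (ρ : CyclicRepresentation.{u, v} 𝕜 A) (η : ρ.H), ‖η‖ = 1 ∧
      ∀ c, inner 𝕜 η (ρ.π c ρ.ξ) = f c := by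
  obtain ⟨σ, hσ⟩ := exists_boundedPositiveFunctional f hf.le
  obtain ⟨η, hη, hηf⟩ := σ.exists_inner_gnsHom_eq f hσ
  set ξ : UniformSpace.Completion σ.PreGNS := (σ.toPreGNS 1 : UniformSpace.Completion σ.PreGNS)
    with hξ
  have hπ : ∀ c, σ.gnsHom c ξ = (σ.toPreGNS c : UniformSpace.Completion σ.PreGNS) := fun c => by
    rw [hξ, σ.gnsHom_apply_coe, mul_one]
  have hle : ‖ξ‖ ≤ 1 := by
    rw [hξ, UniformSpace.Completion.norm_coe]
    exact (σ.norm_toPreGNS_le 1).trans norm_one.le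
  -- Both vectors have norm at most one, and `‖f‖ ≤ ‖η‖ * ‖ξ‖`; hence `‖f‖ = 1` makes both unit
  -- vectors.
  have hprod : 1 ≤ ‖η‖ * ‖ξ‖ := by
    rw [← hf]
    refine f.opNorm_le_bound (by positivity) fun c => ?_
    rw [← hηf, mul_assoc]
    refine (norm_inner_le_norm _ _).trans ?_
    gcongr
    rw [hξ, UniformSpace.Completion.norm_coe, UniformSpace.Completion.norm_coe, mul_comm]
    simpa using σ.norm_toPreGNS_mul_le c 1
  have hξ1 : ‖ξ‖ = 1 := le_antisymm hle (by nlinarith [norm_nonneg ξ])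
  have hη1 : ‖η‖ = 1 := le_antisymm hη (by rwa [hξ1, mul_one] at hprod)
  refine ⟨{ H := UniformSpace.Completion σ.PreGNS, π := σ.gnsHom, ξ := ξ, norm_ξ := hξ1,
            cyclic := ?_ }, η, hη1, fun c => ?_⟩
  · simp only [hπ]
    exact UniformSpace.Completion.denseRange_coe.comp σ.toPreGNS.surjective.denseRange
      (UniformSpace.Completion.continuous_coe _)
  · change inner 𝕜 η (σ.gnsHom c ξ) = f c
    rw [hπ, hηf]

/-- A unital `*`-homomorphism of a C*-algebra over `ℝ` or `ℂ` into the bounded operators on a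
Hilbert space is contractive. -/
theorem norm_starAlgHom_apply_le [NormOneClass A] [PositiveStarSquares A] {H : Type*}
    [NormedAddCommGroup H] [InnerProductSpace 𝕜 H] [CompleteSpace H] [Nontrivial H]
    (π : A →⋆ₐ[𝕜] (H →L[𝕜] H)) (x : A) : ‖π x‖ ≤ ‖x‖ := by
  let _ : NormedAlgebra ℝ A := NormedAlgebra.restrictScalars ℝ 𝕜 A
  have : IsScalarTower ℝ 𝕜 A := RestrictScalars.isScalarTower ℝ 𝕜 A
  have : StarModule ℝ A := starModule_real 𝕜 A
  let _ : NormedAlgebra ℝ (H →L[𝕜] H) := NormedAlgebra.restrictScalars ℝ 𝕜 (H →L[𝕜] H)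
  have hr : ∀ r : ℝ, π (algebraMap ℝ A r) = algebraMap ℝ (H →L[𝕜] H) r := fun r =>
    π.toAlgHom.commutes (algebraMap ℝ 𝕜 r)
  have hs : star (star x * x) = star x * x := by rw [star_mul, star_star]
  -- The invertibility needed in the operator algebra is transported from `A` by `π`, which also
  -- sends the resolvent set of `star x * x` into that of its image.
  obtain ⟨r, hr1, hr2⟩ := exists_spectrum_abs_eq_norm (x := π (star x * x))
    (by rw [← map_star, hs]) (fun α β hβ => by
      rw [← hr, ← hr, ← map_sub, ← map_mul, ← map_add]
      have h := isUnit_star_mul_self_add_algebraMap (star x * x - algebraMap ℝ A α)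
        (mul_self_pos.2 hβ)
      rw [star_sub, hs, star_algebraMap_real] at h
      exact h.map π)
  have h1 : r ∈ spectrum ℝ (star x * x) := fun h => hr1 (by
    have := h.map π
    rwa [map_sub, hr] at this)
  have h2 := spectrum.norm_le_norm_of_mem h1
  rw [Real.norm_eq_abs, hr2, map_mul, map_star, CStarRing.norm_star_mul_self] at h2
  have h3 : ‖π x‖ * ‖π x‖ = ‖star (π x) * π x‖ := CStarRing.norm_star_mul_self.symm
  exact (mul_self_le_mul_self_iff (norm_nonneg (π x)) (norm_nonneg x)).2 (h3.trans_le h2)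

end Distance

/-! ### The distance formula -/

/-- A functional of norm one vanishing on a non-dense subspace and attaining the distance of a
given point to it. -/
theorem exists_dual_vector_infDist {𝕜 E : Type*} [RCLike 𝕜] [NormedAddCommGroup E]
    [NormedSpace 𝕜 E] (B : Submodule 𝕜 E) (hB : ¬ Dense (B : Set E)) (a : E) :
    ∃ f : StrongDual 𝕜 E, ‖f‖ = 1 ∧ (∀ b ∈ B, f b = 0) ∧
      f a = (Metric.infDist a (B : Set E) : ℝ) := by
  set C := B.topologicalClosure with hC
  have hne : C ≠ ⊤ := fun h => hB (Submodule.dense_iff_topologicalClosure_eq_top.2 h)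
  have : IsClosed (C : Set E) := B.isClosed_topologicalClosure
  have : Nontrivial (E ⧸ C) := Submodule.Quotient.nontrivial_iff.2 hne
  obtain ⟨g, hg, hga⟩ := exists_dual_vector' 𝕜 (C.mkQ a)
  let f : StrongDual 𝕜 E := (g.toLinearMap ∘ₗ C.mkQ).mkContinuous 1 fun x => by
    rw [one_mul]
    refine (g.le_of_opNorm_le hg.le _).trans ?_
    rw [one_mul]
    exact Submodule.Quotient.norm_mk_le C x
  have hfg : ∀ x, f x = g (C.mkQ x) := fun x => rfl
  refine ⟨f, le_antisymm (LinearMap.mkContinuous_norm_le _ zero_le_one _) ?_, fun b hb => ?_, ?_⟩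
  · rw [← hg]
    refine g.opNorm_le_bound (norm_nonneg _) fun y => ?_
    refine le_of_forall_pos_le_add fun ε hε => ?_
    obtain ⟨x, rfl, hx⟩ := Submodule.Quotient.norm_mk_lt y hε
    have h1 : ‖f‖ ≤ 1 := LinearMap.mkContinuous_norm_le _ zero_le_one _
    have h2 := f.le_opNorm x
    rw [hfg] at h2
    change ‖g (C.mkQ x)‖ ≤ _
    nlinarith [norm_nonneg f]
  · rw [hfg, Submodule.mkQ_apply,
      (Submodule.Quotient.mk_eq_zero C (x := b)).2 (B.le_topologicalClosure hb), map_zero]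
  · rw [hfg, hga, ← Metric.infDist_closure, ← Submodule.topologicalClosure_coe, ← hC]
    congr 1
    exact QuotientAddGroup.norm_mk (S := C.toAddSubgroup) a

/-- Mathlib's inner product is conjugate linear in its first argument, so `⟨π(a)ξ | η⟩`, linear in
`π(a)ξ`, is `inner 𝕜 η (π a ξ)`. -/
theorem mainTheorem5 {𝕜 : Type v} {A : Type u} [RCLike 𝕜] [NormedRing A] [StarRing A]
    [CStarRing A] [CompleteSpace A] [NormedAlgebra 𝕜 A] [StarModule 𝕜 A] [PositiveStarSquares A]
    (a : A) (B : Submodule 𝕜 A) (hB : ¬ Dense (B : Set A))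
    (hbest : ∃ b₀ : A, IsBestApproximation a B b₀) :
    IsGreatest
      {r : ℝ | ∃ (ρ : CyclicRepresentation.{u, v} 𝕜 A) (η : ρ.H), ‖η‖ = 1 ∧
        (∀ b ∈ B, inner 𝕜 η (ρ.π b ρ.ξ) = 0) ∧ r = ‖inner 𝕜 η (ρ.π a ρ.ξ)‖}
      (Metric.infDist a (B : Set A)) := by
  have : Nontrivial A := by
    by_contra h
    rw [not_nontrivial_iff_subsingleton] at h
    exact hB fun x => subset_closure (by rw [Subsingleton.elim x 0]; exact B.zero_mem)
  have : NormOneClass A := ⟨CStarRing.norm_one⟩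
  constructor
  · obtain ⟨f, hf, hfB, hfa⟩ := exists_dual_vector_infDist B hB a
    obtain ⟨ρ, η, hη, h⟩ := exists_cyclicRepresentation f hf
    refine ⟨ρ, η, hη, fun b hb => by rw [h, hfB b hb], ?_⟩
    rw [h, hfa, RCLike.norm_ofReal, abs_of_nonneg Metric.infDist_nonneg]
  · rintro r ⟨ρ, η, hη, hB0, rfl⟩
    have : Nontrivial ρ.H := ⟨ρ.ξ, 0, fun h => by simpa [h] using ρ.norm_ξ⟩
    refine (Metric.le_infDist ⟨0, B.zero_mem⟩).2 fun b hb => ?_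
    have h1 : inner 𝕜 η (ρ.π a ρ.ξ) = inner 𝕜 η (ρ.π (a - b) ρ.ξ) := by
      rw [map_sub, sub_apply, inner_sub_right, hB0 b hb, sub_zero]
    rw [h1, dist_eq_norm]
    refine (norm_inner_le_norm _ _).trans ?_
    rw [hη, one_mul]
    refine ((ρ.π (a - b)).le_opNorm _).trans ?_
    rw [ρ.norm_ξ, mul_one]
    exact norm_starAlgHom_apply_le ρ.π _
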